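/- Let $T:[0,1]\to[0,1]$ be the Gauss map, $T(x)=\frac1x-\lfloor \frac1x\rfloor$ for $x>0$ and $T(0)=0$. Define $\hat T_{slow}:[0,1]^2\to[0,1]^2$ by $$\hat T_{slow}(x,y)=\begin{cases}\left(T(x),\frac{1-y}{x}\right) & \text{if } x\neq 0,\ y\ge 1-x,\\[2pt] \left(T(1-x),\frac{y}{1-x}\right) & \text{if } x\neq 0,\ y<1-x,\\[2pt] (0,y) & \text{if } x=0.\end{cases}$$ Let $F=\{(x,y)\in[0,1]^2: y\ge 1-x \text{ or } x>1/2\}$ and $$N_F(x,y)=\min\{n\ge 0:\hat T_{slow}^{\,n}(x,y)\in F\}.$$ (This minimum exists whenever $x$ is irrational; where no such $n$ exists, which is a Lebesgue null set, put $N_F(x,y)=0$.) The accelerated map is $$\hat T_{fast}(x,y)=\hat T_{slow}^{\,N_F(x,y)+1}(x,y).$$ Theorem. There is a probability measure $\hat\mu$ on $[0,1]^2$, mutually absolutely continuous with respect to Lebesgue measure, for which $\hat T_{fast}$ is ergodic; that is, $\hat T_{fast}$ preserves $\hat\mu$, and every measurable set $A$ with $\hat T_{fast}^{-1}(A)=A$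 satisfies $\hat\mu(A)\in\{0,1\}$. -/

import Mathlib

noncomputable section

namespace RotationRenormalization

/-- The Gauss map `T(x) = 1/x - ⌊1/x⌋` of the unit interval (with `T(0) = 0`). -/
def gauss (x : unitInterval) : unitInterval :=
  ⟨Int.fract (1 / (x : ℝ)), Int.fract_nonneg _, (Int.fract_lt_one _).le⟩

theorem green_mem {x y : unitInterval} (h : 1 - (x : ℝ) ≤ y) :
    (1 - (y : ℝ)) / x ∈ unitInterval :=
  ⟨div_nonneg (sub_nonneg.2 y.2.2) x.2.1, div_le_one_of_le₀ (by linarith) x.2.1⟩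

theorem red_mem {x y : unitInterval} (h : ¬ 1 - (x : ℝ) ≤ y) :
    (y : ℝ) / (1 - x) ∈ unitInterval :=
  ⟨div_nonneg y.2.1 (sub_nonneg.2 x.2.2),
    div_le_one_of_le₀ (not_le.1 h).le (sub_nonneg.2 x.2.2)⟩

/-- The slow map on `[0,1]²`: `(x, y) ↦ (T(x), (1 - y) / x)` if `y ≥ 1 - x` ("green edge") and
`(x, y) ↦ (T(1 - x), y / (1 - x))` if `y < 1 - x` ("red edge"); it is the identity on `x = 0`.
On the line `x = 1` the green formula gives `(1, y) ↦ (0, 1 - y)`. -/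
def slowMap (p : unitInterval × unitInterval) : unitInterval × unitInterval :=
  if (p.1 : ℝ) = 0 then p
  else if h : 1 - (p.1 : ℝ) ≤ p.2 then
    (gauss p.1, ⟨(1 - (p.2 : ℝ)) / p.1, green_mem h⟩)
  else
    (gauss (unitInterval.symm p.1), ⟨(p.2 : ℝ) / (1 - p.1), red_mem h⟩)

/-- The set `F = {(x, y) : y ≥ 1 - x or x > 1/2}`: off `F`, the slow map follows the red edge with
`⌊1/(1 - x)⌋ = 1` (apart from points with `x = 1/2`). -/
def stopSet : Set (unitInterval × unitInterval) :=
  {p | 1 - (p.1 : ℝ) ≤ p.2 ∨ 1 / 2 < (p.1 : ℝ)}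

/-- `N_F(p)`, the least `n ≥ 0` for which the `n`-th slow iterate of `p` lies in `F`. It exists
whenever the first coordinate of `p` is irrational; if no such `n` exists the value is `0`. -/
def entryTime (p : unitInterval × unitInterval) : ℕ :=
  sInf {n : ℕ | slowMap^[n] p ∈ stopSet}

/-- The fast map: iterate the slow map until entering `F`, then apply it once more. -/
def fastMap (p : unitInterval × unitInterval) : unitInterval × unitInterval :=
  slowMap^[entryTime p + 1] p

end RotationRenormalization

end

/-!
The slow map is projective with full branches, and so is the fast map: outside a null set the unit
square is the disjoint union of the images of the inverse branches `branch b`. Such a branch is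
`n` applications of the parabolic map `(x, y) ↦ (x / (1 + x), y / (1 + x))` (the inverse of the red
branch with digit `1`), preceded by the inverse of a branch on the stop set. Its first coordinate
depends on `u` only and it is affine in `v`, so its Jacobian is `1 / D(u) ^ 3`, where `D` is the
common denominator.

Jumping over the parabolic branch makes the inverse branches uniformly contracting. In the
projective coordinates `s = 1 / (1 + u)`, `η = v / (1 + u)` each of them contracts `s` by `4 / 9`
and `η` by `2 / 3`, up to a bounded shear, so the weighted distance `18 |Δs| + |Δη|` is contracted
by `2 / 3` (`projDist_branch_le`). The logarithm of the Jacobian is Lipschitz for this distance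
uniformly over all branches (`logLipschitz_branchJacobian`). Consequently the transfer operator
sends `κ`-log-Lipschitz functions to `(c + 2 κ / 3)`-log-Lipschitz ones, with a fixed `c`, and its
iterates have log-Lipschitz constants that are eventually bounded independently of the start.

Applied to the constant `1`, this bounds the densities of all push-forwards of Lebesgue measure
above and below. The ultrafilter limit of their Cesàro averages is finitely additive and invariant,
and, being squeezed between two multiples of Lebesgue measure, it is a measure equivalent to it
(`exists_invariant_equivalent`). Applied to arbitrary log-Lipschitz densities `f`, it shows that an
invariant set `A` satisfies `μ A * ∫ f ≤ K * ∫_A f` with `K` independent of `f`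
(`IsFullBranched.measure_mul_lintegral_le`). Approximating the indicator of a closed subset of the
complement of `A` by such `f` forces `A` or its complement to be null
(`IsFullBranched.measure_eq_zero_or`).
-/

open MeasureTheory Filter Topology Set
open scoped ENNReal

namespace RotationRenormalization

/-! ### Invariant measures from uniform bounds on the iterates -/

section InvariantMeasure

variable {Ω : Type*} [MeasurableSpace Ω]

/-- The Cesàro average of the first `n + 1` push-forwards of `μ` under the iterates of `T`. -/
noncomputable def cesaro (T : Ω → Ω) (μ : Measure Ω) (n : ℕ) : Measure Ω :=
  ((n + 1 : ℕ) : ℝ≥0∞)⁻¹ • ∑ k ∈ Finset.range (n + 1), μ.map (T^[k])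

theorem cesaro_apply {T : Ω → Ω} (hT : Measurable T) (μ : Measure Ω) (n : ℕ) {A : Set Ω}
    (hA : MeasurableSet A) :
    cesaro T μ n A =
      ((n + 1 : ℕ) : ℝ≥0∞)⁻¹ * ∑ k ∈ Finset.range (n + 1), μ (T^[k] ⁻¹' A) := by
  simp [cesaro, Measure.finsetSum_apply, Measure.map_apply (hT.iterate _) hA]

/-- The limit of the Cesàro averages of `μ A` along a fixed non-principal ultrafilter; it exists
for every set because `ℝ≥0∞` is compact. -/
noncomputable def cesaroLim (T : Ω → Ω) (μ : Measure Ω) (A : Set Ω) : ℝ≥0∞ :=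
  ((hyperfilter ℕ).map fun n => cesaro T μ n A).lim

theorem tendsto_cesaroLim (T : Ω → Ω) (μ : Measure Ω) (A : Set Ω) :
    Tendsto (fun n => cesaro T μ n A) (hyperfilter ℕ) (𝓝 (cesaroLim T μ A)) :=
  Ultrafilter.le_nhds_lim ((hyperfilter ℕ).map fun n => cesaro T μ n A)

theorem hyperfilter_nat_le_atTop : (hyperfilter ℕ : Filter ℕ) ≤ atTop := by
  rw [← Nat.cofinite_eq_atTop]; exact hyperfilter_le_cofinite

theorem cesaroLim_congr {T : Ω → Ω} {μ : Measure Ω} {A : Set Ω} {a : ℝ≥0∞}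
    (h : Tendsto (fun n => cesaro T μ n A) (hyperfilter ℕ) (𝓝 a)) : cesaroLim T μ A = a :=
  tendsto_nhds_unique (tendsto_cesaroLim T μ A) h

theorem cesaroLim_empty (T : Ω → Ω) (μ : Measure Ω) : cesaroLim T μ ∅ = 0 :=
  cesaroLim_congr (by simp)

theorem cesaroLim_union (T : Ω → Ω) (μ : Measure Ω) {A B : Set Ω} (hAB : Disjoint A B)
    (hB : MeasurableSet B) : cesaroLim T μ (A ∪ B) = cesaroLim T μ A + cesaroLim T μ B := by
  refine cesaroLim_congr ?_
  simp_rw [measure_union hAB hB]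
  exact (tendsto_cesaroLim T μ A).add (tendsto_cesaroLim T μ B)

theorem inv_mul_sum_le (n : ℕ) {f : ℕ → ℝ≥0∞} {c : ℝ≥0∞} (h : ∀ k, f k ≤ c) :
    ((n + 1 : ℕ) : ℝ≥0∞)⁻¹ * ∑ k ∈ Finset.range (n + 1), f k ≤ c := by
  calc _ ≤ ((n + 1 : ℕ) : ℝ≥0∞)⁻¹ * ∑ k ∈ Finset.range (n + 1), c := by gcongr; exact h _
    _ = c := by
      rw [Finset.sum_const, Finset.card_range, nsmul_eq_mul, ← mul_assoc,
        ENNReal.inv_mul_cancel (by simp) (by simp), one_mul]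

theorem le_inv_mul_sum (n : ℕ) {f : ℕ → ℝ≥0∞} {c : ℝ≥0∞} (h : ∀ k, c ≤ f k) :
    c ≤ ((n + 1 : ℕ) : ℝ≥0∞)⁻¹ * ∑ k ∈ Finset.range (n + 1), f k := by
  calc c = ((n + 1 : ℕ) : ℝ≥0∞)⁻¹ * ∑ k ∈ Finset.range (n + 1), c := by
        rw [Finset.sum_const, Finset.card_range, nsmul_eq_mul, ← mul_assoc,
          ENNReal.inv_mul_cancel (by simp) (by simp), one_mul]
    _ ≤ _ := by gcongr; exact h _

theorem cesaroLim_le {T : Ω → Ω} (hT : Measurable T) {μ : Measure Ω} {K : ℝ≥0∞} {A : Set Ω}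
    (hA : MeasurableSet A) (h : ∀ n, μ (T^[n] ⁻¹' A) ≤ K * μ A) :
    cesaroLim T μ A ≤ K * μ A :=
  le_of_tendsto (tendsto_cesaroLim T μ A) <| .of_forall fun n => by
    rw [cesaro_apply hT μ n hA]; exact inv_mul_sum_le n h

theorem le_mul_cesaroLim {T : Ω → Ω} (hT : Measurable T) {μ : Measure Ω} {K : ℝ≥0∞}
    (hK : K ≠ ∞) {A : Set Ω} (hA : MeasurableSet A) (h : ∀ n, μ A ≤ K * μ (T^[n] ⁻¹' A)) :
    μ A ≤ K * cesaroLim T μ A := by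
  refine ge_of_tendsto (ENNReal.Tendsto.const_mul (tendsto_cesaroLim T μ A) (.inr hK)) <|
    .of_forall fun n => ?_
  rw [cesaro_apply hT μ n hA, mul_left_comm, Finset.mul_sum]
  exact le_inv_mul_sum n h

theorem cesaroLim_preimage {T : Ω → Ω} (hT : Measurable T) (μ : Measure Ω)
    [IsProbabilityMeasure μ] {A : Set Ω} (hA : MeasurableSet A) :
    cesaroLim T μ (T ⁻¹' A) = cesaroLim T μ A := by
  have hzero (B : ℕ → Set Ω) : Tendsto (fun n : ℕ => ((n + 1 : ℕ) : ℝ≥0∞)⁻¹ * μ (B n))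
      (hyperfilter ℕ) (𝓝 0) := by
    refine Tendsto.mono_left ?_ hyperfilter_nat_le_atTop
    refine tendsto_of_tendsto_of_tendsto_of_le_of_le tendsto_const_nhds
      ((tendsto_add_atTop_iff_nat 1).2 ENNReal.tendsto_inv_nat_nhds_zero) (fun _ => zero_le) ?_
    exact fun n => mul_le_of_le_one_right zero_le prob_le_one
  -- The two averages differ by a first and a last term, each at most `1 / (n + 1)`.
  have hshift (n : ℕ) : cesaro T μ n (T ⁻¹' A) + ((n + 1 : ℕ) : ℝ≥0∞)⁻¹ * μ A =
      cesaro T μ n A + ((n + 1 : ℕ) : ℝ≥0∞)⁻¹ * μ (T^[n + 1] ⁻¹' A) := by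
    rw [cesaro_apply hT μ n hA, cesaro_apply hT μ n (hT hA), ← mul_add, ← mul_add,
      ← Finset.sum_range_succ (fun k => μ (T^[k] ⁻¹' A)),
      Finset.sum_range_succ' (fun k => μ (T^[k] ⁻¹' A))]
    simp_rw [Function.iterate_succ', preimage_comp, Function.iterate_zero, preimage_id]
  have h1 := (tendsto_cesaroLim T μ (T ⁻¹' A)).add (hzero fun _ => A)
  have h2 := (tendsto_cesaroLim T μ A).add (hzero fun n => T^[n + 1] ⁻¹' A)
  simp_rw [hshift] at h1
  simpa using tendsto_nhds_unique h1 h2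

/-- Domination by a finite measure upgrades the finite additivity of the ultrafilter limit to
countable additivity. -/
theorem cesaroLim_iUnion {T : Ω → Ω} (hT : Measurable T) {μ : Measure Ω}
    [IsProbabilityMeasure μ] {K : ℝ≥0∞} (hK : K ≠ ∞)
    (h : ∀ n A, MeasurableSet A → μ (T^[n] ⁻¹' A) ≤ K * μ A) {B : ℕ → Set Ω}
    (hB : ∀ i, MeasurableSet (B i)) (hd : Pairwise (Function.onFun Disjoint B)) :
    cesaroLim T μ (⋃ i, B i) = ∑' i, cesaroLim T μ (B i) := by
  have hsplit (N : ℕ) : cesaroLim T μ (⋃ i, B i) =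
      ∑ i ∈ Finset.range N, cesaroLim T μ (B i) + cesaroLim T μ (⋃ i, B (i + N)) := by
    induction N with
    | zero => simp
    | succ N ih =>
      have hU : (⋃ i, B (i + N)) = B N ∪ ⋃ i, B (i + (N + 1)) := by
        rw [← union_iUnion_nat_succ fun i => B (i + N)]
        simp [add_assoc, add_comm 1 N]
      rw [ih, Finset.sum_range_succ, add_assoc, hU, cesaroLim_union]
      · exact disjoint_iUnion_right.2 fun i => hd (by omega)
      · exact .iUnion fun i => hB _
  have htail : Tendsto (fun N => cesaroLim T μ (⋃ i, B (i + N))) atTop (𝓝 0) := by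
    have hsum : ∑' i, μ (B i) ≠ ∞ := by
      rw [← measure_iUnion hd hB]; exact measure_ne_top _ _
    have h0 := ENNReal.Tendsto.const_mul (ENNReal.tendsto_sum_nat_add _ hsum) (.inr hK)
    rw [mul_zero] at h0
    refine tendsto_of_tendsto_of_tendsto_of_le_of_le tendsto_const_nhds h0 (fun _ => zero_le)
      fun N => ?_
    have hm : MeasurableSet (⋃ i, B (i + N)) := .iUnion fun i => hB _
    refine (cesaroLim_le hT hm fun n => h n _ hm).trans ?_
    gcongr
    exact measure_iUnion_le _
  have hlim := (ENNReal.tendsto_nat_tsum fun i => cesaroLim T μ (B i)).add htail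
  simp_rw [← hsplit, add_zero] at hlim
  exact tendsto_nhds_unique tendsto_const_nhds hlim

/-- If all iterates of `T` distort a probability measure `μ` by at most a constant factor, then
`T` preserves a probability measure equivalent to `μ`. -/
theorem exists_invariant_equivalent {T : Ω → Ω} (hT : Measurable T) (μ : Measure Ω)
    [IsProbabilityMeasure μ] {K : ℝ≥0∞} (hK : K ≠ ∞)
    (hle : ∀ n A, MeasurableSet A → μ (T^[n] ⁻¹' A) ≤ K * μ A)
    (hge : ∀ n A, MeasurableSet A → μ A ≤ K * μ (T^[n] ⁻¹' A)) :
    ∃ ν : Measure Ω, IsProbabilityMeasure ν ∧ ν ≪ μ ∧ μ ≪ ν ∧ MeasurePreserving T ν ν := by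
  let ν : Measure Ω := Measure.ofMeasurable (fun A _ => cesaroLim T μ A) (cesaroLim_empty T μ)
    fun B hB hd => cesaroLim_iUnion hT hK hle hB hd
  have hν {A : Set Ω} (hA : MeasurableSet A) : ν A = cesaroLim T μ A :=
    Measure.ofMeasurable_apply A hA
  refine ⟨ν, ⟨?_⟩, ?_, ?_, hT, ?_⟩
  · rw [hν .univ]
    refine cesaroLim_congr (tendsto_const_nhds.congr fun n => ?_)
    refine le_antisymm ?_ ?_ <;> rw [cesaro_apply hT μ n .univ]
    · exact le_inv_mul_sum n (by simp)
    · exact inv_mul_sum_le n (by simp)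
  · refine Measure.AbsolutelyContinuous.mk fun A hA h0 => ?_
    rw [hν hA]
    simpa [h0] using cesaroLim_le hT hA fun n => hle n A hA
  · refine Measure.AbsolutelyContinuous.mk fun A hA h0 => ?_
    rw [hν hA] at h0
    simpa [h0] using le_mul_cesaroLim hT hK hA fun n => hge n A hA
  · ext A hA
    rw [Measure.map_apply hT hA, hν hA, hν (hT hA), cesaroLim_preimage hT μ hA]

end InvariantMeasure

/-! ### Transfer operators of contracting inverse branches -/

section Transfer

variable {Ω ι : Type*} {φ : ι → Ω → Ω} {J : ι → Ω → ℝ≥0∞} {d : Ω → Ω → ℝ}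

/-- The transfer operator of a family of inverse branches `φ` with Jacobians `J`. -/
noncomputable def transfer (φ : ι → Ω → Ω) (J : ι → Ω → ℝ≥0∞) (f : Ω → ℝ≥0∞) (z : Ω) : ℝ≥0∞ :=
  ∑' b, J b z * f (φ b z)

/-- `f` is log-Lipschitz with constant `κ` for the distance function `d`, stated without
logarithms so that the values `0` and `∞` are allowed. -/
def LogLipschitz (d : Ω → Ω → ℝ) (κ : ℝ) (f : Ω → ℝ≥0∞) : Prop :=
  ∀ z z', f z ≤ ENNReal.ofReal (Real.exp (κ * d z z')) * f z'

theorem logLipschitz_one (hd : ∀ z z', 0 ≤ d z z') {κ : ℝ} (hκ : 0 ≤ κ) :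
    LogLipschitz d κ (1 : Ω → ℝ≥0∞) := fun z z' => by
  simpa using Real.one_le_exp (mul_nonneg hκ (hd z z'))

/-- Contraction of the branches by `2 / 3` and log-Lipschitz Jacobians make the transfer operator
contract the log-Lipschitz constant, up to an additive error. -/
theorem LogLipschitz.transfer {c κ : ℝ} (hκ : 0 ≤ κ)
    (hφ : ∀ b z z', d (φ b z) (φ b z') ≤ 2 / 3 * d z z') (hJ : ∀ b, LogLipschitz d c (J b))
    {f : Ω → ℝ≥0∞} (hf : LogLipschitz d κ f) :
    LogLipschitz d (c + 2 / 3 * κ) (transfer φ J f) := fun z z' => by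
  rw [RotationRenormalization.transfer, RotationRenormalization.transfer, ← ENNReal.tsum_mul_left]
  refine ENNReal.tsum_le_tsum fun b => ?_
  calc J b z * f (φ b z)
      ≤ (ENNReal.ofReal (Real.exp (c * d z z')) * J b z') *
          (ENNReal.ofReal (Real.exp (κ * d (φ b z) (φ b z'))) * f (φ b z')) :=
        mul_le_mul' (hJ b z z') (hf _ _)
    _ ≤ (ENNReal.ofReal (Real.exp (c * d z z')) * J b z') *
          (ENNReal.ofReal (Real.exp (κ * (2 / 3 * d z z'))) * f (φ b z')) := by
        gcongr; exact hφ b z z'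
    _ = _ := by
        rw [show (c + 2 / 3 * κ) * d z z' = c * d z z' + κ * (2 / 3 * d z z') by ring,
          Real.exp_add, ENNReal.ofReal_mul (Real.exp_nonneg _)]
        ring

theorem LogLipschitz.transfer_iterate {c κ : ℝ} (hc : 0 ≤ c) (hκ : 0 ≤ κ)
    (hφ : ∀ b z z', d (φ b z) (φ b z') ≤ 2 / 3 * d z z') (hJ : ∀ b, LogLipschitz d c (J b))
    (hd : ∀ z z', 0 ≤ d z z') {f : Ω → ℝ≥0∞} (hf : LogLipschitz d κ f) (n : ℕ) :
    LogLipschitz d (3 * c + (2 / 3) ^ n * κ)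
      ((RotationRenormalization.transfer φ J)^[n] f) := by
  induction n with
  | zero =>
    refine fun z z' => (hf z z').trans ?_
    rw [Function.iterate_zero_apply, pow_zero, one_mul]
    gcongr
    · exact hd z z'
    · linarith
  | succ n ih =>
    rw [Function.iterate_succ_apply']
    have h := ih.transfer (by positivity) hφ hJ
    rwa [show c + 2 / 3 * (3 * c + (2 / 3) ^ n * κ) = 3 * c + (2 / 3) ^ (n + 1) * κ by ring] at h

/-- A Lipschitz function bounded below by a positive constant is log-Lipschitz. -/
theorem logLipschitz_add_const [PseudoEMetricSpace Ω] {C : ℝ} (hC0 : 0 ≤ C)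
    (hd : ∀ z z', 0 ≤ d z z')
    (hC : ∀ z z' : Ω, edist z z' ≤ ENNReal.ofReal (C * d z z')) {K : NNReal} {f : Ω → NNReal}
    (hf : LipschitzWith K f) {ε : NNReal} (hε : 0 < ε) :
    LogLipschitz d (K * C / ε) fun z => ((f z + ε : NNReal) : ℝ≥0∞) := fun z z' => by
  have h1 : edist (f z) (f z') ≤ ENNReal.ofReal (K * (C * d z z')) := by
    refine (hf z z').trans ?_
    rw [ENNReal.ofReal_mul (p := (K : ℝ)) K.2, ENNReal.ofReal_coe_nnreal]
    gcongr
    exact hC z z'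
  have hnn : 0 ≤ K * (C * d z z') := by have := hd z z'; positivity
  rw [edist_dist, ENNReal.ofReal_le_ofReal_iff hnn, NNReal.dist_eq] at h1
  have hε' : (0 : ℝ) < ε := hε
  beta_reduce
  rw [← ENNReal.ofReal_coe_nnreal, ← ENNReal.ofReal_coe_nnreal,
    ← ENNReal.ofReal_mul (Real.exp_nonneg _), NNReal.coe_add, NNReal.coe_add]
  refine ENNReal.ofReal_le_ofReal ?_
  have hpos : (0 : ℝ) ≤ K * (C * d z z') / ε * f z' := by positivity
  calc (f z : ℝ) + ε ≤ (f z' + ε) + K * (C * d z z') := by linarith [le_abs_self ((f z : ℝ) - f z')]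
    _ ≤ (K * (C * d z z') / ε + 1) * (f z' + ε) := by
      have : K * (C * d z z') / ε * ε = K * (C * d z z') := div_mul_cancel₀ _ hε'.ne'
      linear_combination hpos - this
    _ ≤ Real.exp (K * C / ε * d z z') * (f z' + ε) := by
      gcongr
      rw [show K * C / ε * d z z' = K * (C * d z z') / ε by ring]
      exact Real.add_one_le_exp _

variable [MeasurableSpace Ω] {T : Ω → Ω} {μ : Measure Ω}

theorem measurable_transfer [Countable ι] (hφm : ∀ b, Measurable (φ b))
    (hJm : ∀ b, Measurable (J b))
    {f : Ω → ℝ≥0∞} (hf : Measurable f) : Measurable (transfer φ J f) :=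
  Measurable.tsum fun b => (hJm b).mul (hf.comp (hφm b))

/-- `φ` is the family of inverse branches, with Jacobians `J`, of a map `T` all of whose branches
are full modulo `μ`. -/
structure IsFullBranched (T : Ω → Ω) (μ : Measure Ω) (φ : ι → Ω → Ω) (J : ι → Ω → ℝ≥0∞) :
    Prop where
  measurable_map : Measurable T
  measurable_branch : ∀ b, Measurable (φ b)
  measurable_jacobian : ∀ b, Measurable (J b)
  lintegral_transfer : ∀ f : Ω → ℝ≥0∞, Measurable f → ∫⁻ z, transfer φ J f z ∂μ = ∫⁻ z, f z ∂μ
  map_branch : ∀ᵐ z ∂μ, ∀ b, T (φ b z) = z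

theorem IsFullBranched.measurable_transfer_iterate [Countable ι] (h : IsFullBranched T μ φ J)
    {f : Ω → ℝ≥0∞} (hf : Measurable f) (n : ℕ) : Measurable ((transfer φ J)^[n] f) := by
  induction n with
  | zero => exact hf
  | succ n ih =>
    rw [Function.iterate_succ_apply']
    exact measurable_transfer h.measurable_branch h.measurable_jacobian ih

theorem IsFullBranched.lintegral_mul_comp (h : IsFullBranched T μ φ J) {f g : Ω → ℝ≥0∞}
    (hf : Measurable f) (hg : Measurable g) :
    ∫⁻ z, f z * g (T z) ∂μ = ∫⁻ z, transfer φ J f z * g z ∂μ := by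
  refine (h.lintegral_transfer (fun z => f z * g (T z))
    (hf.mul (hg.comp h.measurable_map))).symm.trans ?_
  refine lintegral_congr_ae ?_
  filter_upwards [h.map_branch] with z hz
  simp only [transfer, hz, ← mul_assoc, ENNReal.tsum_mul_right]

/-- The iterates of the transfer operator are dual to composition with the iterates of the map. -/
theorem IsFullBranched.lintegral_mul_comp_iterate [Countable ι] (h : IsFullBranched T μ φ J)
    {f g : Ω → ℝ≥0∞} (hf : Measurable f) (hg : Measurable g) (n : ℕ) :
    ∫⁻ z, f z * g (T^[n] z) ∂μ = ∫⁻ z, (transfer φ J)^[n] f z * g z ∂μ := by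
  induction n generalizing g with
  | zero => rfl
  | succ n ih =>
    simp_rw [Function.iterate_succ_apply']
    refine (ih (hg.comp h.measurable_map)).trans ?_
    exact h.lintegral_mul_comp (h.measurable_transfer_iterate hf n) hg

theorem IsFullBranched.setLIntegral_preimage_iterate [Countable ι] (h : IsFullBranched T μ φ J)
    {f : Ω → ℝ≥0∞} (hf : Measurable f) {A : Set Ω} (hA : MeasurableSet A) (n : ℕ) :
    ∫⁻ z in T^[n] ⁻¹' A, f z ∂μ = ∫⁻ z in A, (transfer φ J)^[n] f z ∂μ := by
  have h1 := h.lintegral_mul_comp_iterate hf (measurable_one.indicator hA) n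
  rw [← lintegral_indicator (h.measurable_map.iterate n hA), ← lintegral_indicator hA]
  refine Eq.trans (lintegral_congr fun z => ?_) (h1.trans (lintegral_congr fun z => ?_))
  · by_cases hz : T^[n] z ∈ A
    · rw [indicator_of_mem (show z ∈ T^[n] ⁻¹' A from hz), indicator_of_mem hz]; simp
    · rw [indicator_of_notMem (show z ∉ T^[n] ⁻¹' A from hz), indicator_of_notMem hz]; simp
  · by_cases hz : z ∈ A <;> simp [hz]

theorem IsFullBranched.lintegral_transfer_iterate [Countable ι] (h : IsFullBranched T μ φ J)
    {f : Ω → ℝ≥0∞} (hf : Measurable f) (n : ℕ) :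
    ∫⁻ z, (transfer φ J)^[n] f z ∂μ = ∫⁻ z, f z ∂μ := by
  simpa using (h.setLIntegral_preimage_iterate hf .univ n).symm

/-- A log-Lipschitz function on a set of bounded `d`-diameter is comparable to its mean. -/
theorem LogLipschitz.le_mul_lintegral [IsProbabilityMeasure μ] {κ D : ℝ} (hκ : 0 ≤ κ)
    (hD : ∀ z z', d z z' ≤ D) {f : Ω → ℝ≥0∞} (hf : LogLipschitz d κ f) (z : Ω) :
    f z ≤ ENNReal.ofReal (Real.exp (κ * D)) * ∫⁻ w, f w ∂μ := by
  rw [← lintegral_const_mul' _ _ ENNReal.ofReal_ne_top]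
  calc f z = ∫⁻ _, f z ∂μ := by simp
    _ ≤ _ := lintegral_mono fun w => (hf z w).trans (by gcongr; exact hD z w)

theorem LogLipschitz.lintegral_le_mul [IsProbabilityMeasure μ] {κ D : ℝ} (hκ : 0 ≤ κ)
    (hD : ∀ z z', d z z' ≤ D) {f : Ω → ℝ≥0∞} (hf : LogLipschitz d κ f) (z : Ω) :
    ∫⁻ w, f w ∂μ ≤ ENNReal.ofReal (Real.exp (κ * D)) * f z := by
  calc ∫⁻ w, f w ∂μ ≤ ∫⁻ _, ENNReal.ofReal (Real.exp (κ * D)) * f z ∂μ :=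
        lintegral_mono fun w => (hf w z).trans (by gcongr; exact hD w z)
    _ = _ := by simp

/-- Metric data for a family of inverse branches: a bounded distance function that all branches
contract by `2 / 3` and for which all Jacobians are log-Lipschitz with constant `c`. -/
structure HasBoundedDistortion (φ : ι → Ω → Ω) (J : ι → Ω → ℝ≥0∞) (d : Ω → Ω → ℝ) (c D : ℝ) :
    Prop where
  const_nonneg : 0 ≤ c
  nonneg : ∀ z z', 0 ≤ d z z'
  le_diam : ∀ z z', d z z' ≤ D
  contract : ∀ b z z', d (φ b z) (φ b z') ≤ 2 / 3 * d z z'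
  jacobian : ∀ b, LogLipschitz d c (J b)

theorem IsFullBranched.measure_preimage_iterate_le [Countable ι] [IsProbabilityMeasure μ] {c D : ℝ}
    (h : IsFullBranched T μ φ J) (hb : HasBoundedDistortion φ J d c D) (n : ℕ) {A : Set Ω}
    (hA : MeasurableSet A) :
    μ (T^[n] ⁻¹' A) ≤ ENNReal.ofReal (Real.exp (3 * c * D)) * μ A ∧
      μ A ≤ ENNReal.ofReal (Real.exp (3 * c * D)) * μ (T^[n] ⁻¹' A) := by
  have hc := hb.const_nonneg
  have hL := (logLipschitz_one hb.nonneg le_rfl).transfer_iterate hc le_rfl hb.contract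
    hb.jacobian hb.nonneg n
  rw [mul_zero, add_zero] at hL
  have hint : ∫⁻ z, (transfer φ J)^[n] 1 z ∂μ = 1 := by
    simpa using h.lintegral_transfer_iterate measurable_one n
  have hpre := h.setLIntegral_preimage_iterate measurable_one hA n
  simp only [Pi.one_apply, setLIntegral_one] at hpre
  rw [hpre]
  constructor
  · calc ∫⁻ z in A, (transfer φ J)^[n] 1 z ∂μ
        ≤ ∫⁻ _ in A, ENNReal.ofReal (Real.exp (3 * c * D)) ∂μ := lintegral_mono fun z => by
          simpa [hint] using hL.le_mul_lintegral (μ := μ) (by positivity) hb.le_diam z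
      _ = _ := setLIntegral_const _ _
  · rw [← lintegral_const_mul' _ _ ENNReal.ofReal_ne_top, ← setLIntegral_one]
    refine lintegral_mono fun z => ?_
    simpa [hint] using hL.lintegral_le_mul (μ := μ) (by positivity) hb.le_diam z

/-- An invariant set carries a fixed proportion of the mass of every log-Lipschitz density; the
proportion does not depend on the log-Lipschitz constant, since iterating the transfer operator
forgets that constant. -/
theorem IsFullBranched.measure_mul_lintegral_le [Countable ι] [IsProbabilityMeasure μ] {c D : ℝ}
    (h : IsFullBranched T μ φ J) (hb : HasBoundedDistortion φ J d c D) {A : Set Ω}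
    (hA : MeasurableSet A) (hTA : T ⁻¹' A = A) {κ : ℝ} (hκ : 0 ≤ κ) {f : Ω → ℝ≥0∞}
    (hf : Measurable f) (hfl : LogLipschitz d κ f) :
    μ A * ∫⁻ z, f z ∂μ ≤ ENNReal.ofReal (Real.exp ((3 * c + 1) * D)) * ∫⁻ z in A, f z ∂μ := by
  have hc := hb.const_nonneg
  obtain ⟨z₀⟩ : Nonempty Ω := nonempty_of_isProbabilityMeasure μ
  have hD : 0 ≤ D := (hb.nonneg z₀ z₀).trans (hb.le_diam z₀ z₀)
  obtain ⟨n, hn⟩ : ∃ n : ℕ, (2 / 3 : ℝ) ^ n * κ ≤ 1 := by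
    have := (tendsto_pow_atTop_nhds_zero_of_lt_one (r := (2 / 3 : ℝ)) (by norm_num)
      (by norm_num)).mul_const κ
    rw [zero_mul] at this
    exact ((this.eventually_lt_const one_pos).mono fun _ => le_of_lt).exists
  have hL := hfl.transfer_iterate hc hκ hb.contract hb.jacobian hb.nonneg n
  have hTn : T^[n] ⁻¹' A = A := by
    rw [preimage_iterate_eq]; exact Function.iterate_fixed hTA n
  have hint := h.lintegral_transfer_iterate hf n
  have hpre := h.setLIntegral_preimage_iterate hf hA n
  rw [hTn] at hpre
  rw [hpre, ← hint, ← lintegral_const_mul' _ _ ENNReal.ofReal_ne_top, mul_comm,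
    ← setLIntegral_const]
  refine lintegral_mono fun z => (hL.lintegral_le_mul (by positivity) hb.le_diam z).trans ?_
  gcongr

/-- A map with full branches of bounded distortion is ergodic for every invariant measure
equivalent to the reference measure. -/
theorem IsFullBranched.measure_eq_zero_or [Countable ι] [IsProbabilityMeasure μ]
    [PseudoEMetricSpace Ω] [BorelSpace Ω] {c D C : ℝ} 
    (h : IsFullBranched T μ φ J) (hb : HasBoundedDistortion φ J d c D)
    (hC0 : 0 ≤ C) (hC : ∀ z z' : Ω, edist z z' ≤ ENNReal.ofReal (C * d z z')) {A : Set Ω}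
    (hA : MeasurableSet A) (hTA : T ⁻¹' A = A) : μ A = 0 ∨ μ Aᶜ = 0 := by
  by_contra! hne
  -- `F` is a closed set of positive measure disjoint from `A`.
  obtain ⟨F, hFA, hF, hFpos⟩ : ∃ F ⊆ Aᶜ, IsClosed F ∧ μ F ≠ 0 := by
    obtain ⟨F, hFA, hF, hlt⟩ :=
      hA.compl.exists_isClosed_lt_add (measure_ne_top μ _) (ε := μ Aᶜ) hne.2
    exact ⟨F, hFA, hF, fun h0 => by simp [h0] at hlt⟩
  let ε : ℕ → NNReal := fun n => ((n + 1 : ℕ) : NNReal)⁻¹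
  have hε (n : ℕ) : 0 < ε n := by positivity
  have hε0 : Tendsto ε atTop (𝓝 0) :=
    (tendsto_add_atTop_iff_nat 1).2 tendsto_inv_atTop_nhds_zero_nat
  have hδ (n : ℕ) : (0 : ℝ) < ε n := hε n
  have hδ0 : Tendsto (fun n => (ε n : ℝ)) atTop (𝓝 0) := NNReal.tendsto_coe.2 hε0
  have hbound (n : ℕ) := h.measure_mul_lintegral_le hb hA hTA (by positivity)
    (by fun_prop)
    (logLipschitz_add_const hC0 hb.nonneg hC (lipschitzWith_thickenedIndicator (hδ n) F) (hε n))
  have hlim (ν : Measure Ω) [IsFiniteMeasure ν] : Tendsto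
      (fun n => ∫⁻ z, ((thickenedIndicator (hδ n) F z + ε n : NNReal) : ℝ≥0∞) ∂ν) atTop
      (𝓝 (ν F)) := by
    have h1 := (tendsto_lintegral_thickenedIndicator_of_isClosed ν hF hδ hδ0).add
      (ENNReal.Tendsto.mul_const (ENNReal.tendsto_coe.2 hε0) (.inr (measure_ne_top ν univ)))
    simp only [ENNReal.coe_zero, zero_mul, add_zero] at h1
    refine h1.congr fun n => ?_
    simp_rw [ENNReal.coe_add]
    rw [lintegral_add_right _ measurable_const, lintegral_const]
  have hle := le_of_tendsto_of_tendsto'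
    (ENNReal.Tendsto.const_mul (hlim μ) (.inr (measure_ne_top μ A)))
    (ENNReal.Tendsto.const_mul (hlim (μ.restrict A)) (.inr ENNReal.ofReal_ne_top)) hbound
  rw [Measure.restrict_apply hF.measurableSet, disjoint_iff_inter_eq_empty.1
    (disjoint_compl_left.mono_left hFA), measure_empty, mul_zero, nonpos_iff_eq_zero,
    mul_eq_zero] at hle
  exact hle.elim hne.1 hFpos

theorem IsFullBranched.exists_ergodic [Countable ι] [IsProbabilityMeasure μ] [PseudoEMetricSpace Ω]
    [BorelSpace Ω] {c D C : ℝ}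
    (h : IsFullBranched T μ φ J) (hb : HasBoundedDistortion φ J d c D)
    (hC0 : 0 ≤ C) (hC : ∀ z z' : Ω, edist z z' ≤ ENNReal.ofReal (C * d z z')) :
    ∃ ν : Measure Ω, IsProbabilityMeasure ν ∧ ν ≪ μ ∧ μ ≪ ν ∧ Ergodic T ν := by
  obtain ⟨ν, hν, hνμ, hμν, hT⟩ := exists_invariant_equivalent h.measurable_map μ
    ENNReal.ofReal_ne_top (fun n A hA => (h.measure_preimage_iterate_le hb n hA).1)
    (fun n A hA => (h.measure_preimage_iterate_le hb n hA).2)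
  refine ⟨ν, hν, hνμ, hμν, hT, ⟨fun A hA hTA => eventuallyConst_set'.2 ?_⟩⟩
  refine (h.measure_eq_zero_or hb hC0 hC hA hTA).imp (fun h0 => ?_) fun h0 => ?_
  · exact ae_eq_empty.2 (hνμ h0)
  · exact ae_eq_univ.2 (hνμ h0)

end Transfer

/-! ### Inverse branches of the fast map -/

/-- The index set of the inverse branches of the fast map: `Sum.inl (n, a)` stands for `n` red
steps with digit `1` followed by a green step with digit `a + 1`, and `Sum.inr (n, a)` for `n` red
steps with digit `1` followed by a red step with digit `a + 2`. -/
abbrev Digit : Type := (ℕ × ℕ) ⊕ (ℕ × ℕ)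

/-- The common denominator of both coordinates of an inverse branch. -/
def branchDenom : Digit → ℝ → ℝ
  | .inl (n, a), u => n + a + 1 + u
  | .inr (n, a), u => 1 + (n + 1) * (a + 1 + u)

/-- The inverse branches of the fast map as projective maps of the plane; the argument is `(u, v)`,
and only its values on the unit square matter. -/
noncomputable def branch (b : Digit) (w : ℝ × ℝ) : ℝ × ℝ :=
  match b with
  | .inl (_, a) => (1 / branchDenom b w.1, (a + 1 + w.1 - w.2) / branchDenom b w.1)
  | .inr (_, a) => ((a + 1 + w.1) / branchDenom b w.1, w.2 / branchDenom b w.1)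

theorem branchDenom_pos (b : Digit) {u : ℝ} (hu : 0 ≤ u) : 1 ≤ branchDenom b u := by
  rcases b with ⟨n, a⟩ | ⟨n, a⟩ <;> simp only [branchDenom]
  · have : (0 : ℝ) ≤ n + a := by positivity
    linarith
  · have : (0 : ℝ) ≤ (n + 1) * (a + 1 + u) := by positivity
    linarith

/-- The inclusion of the unit square in the plane. -/
def squareCoe (p : unitInterval × unitInterval) : ℝ × ℝ := (p.1, p.2)

/-- The nearest-point retraction of the plane onto the unit square. -/
noncomputable def squareProj (w : ℝ × ℝ) : unitInterval × unitInterval :=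
  (projIcc 0 1 zero_le_one w.1, projIcc 0 1 zero_le_one w.2)

theorem squareProj_squareCoe (p : unitInterval × unitInterval) : squareProj (squareCoe p) = p := by
  simp [squareProj, squareCoe]

theorem squareCoe_squareProj {w : ℝ × ℝ} (hw : w ∈ Icc (0 : ℝ) 1 ×ˢ Icc (0 : ℝ) 1) :
    squareCoe (squareProj w) = w := by
  simp [squareProj, squareCoe, projIcc_of_mem zero_le_one hw.1, projIcc_of_mem zero_le_one hw.2]

theorem squareCoe_mem (p : unitInterval × unitInterval) :
    squareCoe p ∈ Icc (0 : ℝ) 1 ×ˢ Icc (0 : ℝ) 1 := ⟨p.1.2, p.2.2⟩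

/-- The inverse branches as self-maps of the unit square. -/
noncomputable def squareBranch (b : Digit) (p : unitInterval × unitInterval) :
    unitInterval × unitInterval :=
  squareProj (branch b (squareCoe p))

/-- The Jacobian of an inverse branch. -/
noncomputable def branchJacobian (b : Digit) (p : unitInterval × unitInterval) : ℝ≥0∞ :=
  ENNReal.ofReal (1 / branchDenom b p.1 ^ 3)

theorem branch_mem_closedSquare (b : Digit) {w : ℝ × ℝ} (hw : w ∈ Icc (0 : ℝ) 1 ×ˢ Icc (0 : ℝ) 1) :
    branch b w ∈ Icc (0 : ℝ) 1 ×ˢ Icc (0 : ℝ) 1 := by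
  obtain ⟨⟨hu, hu1⟩, hv, hv1⟩ := hw
  have hD := branchDenom_pos b hu
  have hD0 : 0 < branchDenom b w.1 := by linarith
  rcases b with ⟨n, a⟩ | ⟨n, a⟩
  · have hn : (0 : ℝ) ≤ n := by positivity
    have ha : (0 : ℝ) ≤ a := by positivity
    refine ⟨⟨by simp only [branch]; positivity, (div_le_one hD0).2 hD⟩,
      div_nonneg (by linarith) hD0.le, (div_le_one hD0).2 ?_⟩
    simp only [branchDenom]; linarith
  · have hn : (0 : ℝ) ≤ n := by positivity
    have ha : (0 : ℝ) ≤ a := by positivity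
    refine ⟨⟨by simp only [branch]; positivity, (div_le_one hD0).2 ?_⟩,
      div_nonneg (by linarith) hD0.le, (div_le_one hD0).2 (by linarith)⟩
    have : 0 ≤ n * (a + 1 + w.1) := by positivity
    simp only [branchDenom]; linarith

theorem squareCoe_squareBranch (b : Digit) (p : unitInterval × unitInterval) :
    squareCoe (squareBranch b p) = branch b (squareCoe p) :=
  squareCoe_squareProj (branch_mem_closedSquare b (squareCoe_mem p))

/-! ### Contraction in projective coordinates -/

/-- The distance of two points of the plane in the projective coordinates
`s = 1 / (1 + u)`, `η = v / (1 + u)`. The weight `18` absorbs the shear of the inverse branches. -/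
noncomputable def projDist (w w' : ℝ × ℝ) : ℝ :=
  18 * |1 / (1 + w.1) - 1 / (1 + w'.1)| + |w.2 / (1 + w.1) - w'.2 / (1 + w'.1)|

theorem projDist_nonneg (w w' : ℝ × ℝ) : 0 ≤ projDist w w' := by unfold projDist; positivity

theorem projCoord_mem {w : ℝ × ℝ} (hw : w ∈ Icc (0 : ℝ) 1 ×ˢ Icc (0 : ℝ) 1) :
    1 / (1 + w.1) ∈ Icc (1 / 2 : ℝ) 1 ∧ w.2 / (1 + w.1) ∈ Icc (0 : ℝ) 1 := by
  obtain ⟨⟨hu, hu1⟩, hv, hv1⟩ := hw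
  have h : 0 < 1 + w.1 := by linarith
  refine ⟨⟨?_, ?_⟩, div_nonneg hv h.le, ?_⟩
  · exact one_div_le_one_div_of_le h (by linarith)
  · rw [div_le_one h]; linarith
  · rw [div_le_one h]; linarith

theorem projDist_le {w w' : ℝ × ℝ} (hw : w ∈ Icc (0 : ℝ) 1 ×ˢ Icc (0 : ℝ) 1)
    (hw' : w' ∈ Icc (0 : ℝ) 1 ×ˢ Icc (0 : ℝ) 1) : projDist w w' ≤ 10 := by
  obtain ⟨⟨h1, h2⟩, h3, h4⟩ := projCoord_mem hw
  obtain ⟨⟨h1', h2'⟩, h3', h4'⟩ := projCoord_mem hw'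
  have hs : |1 / (1 + w.1) - 1 / (1 + w'.1)| ≤ 1 / 2 := abs_le.2 ⟨by linarith, by linarith⟩
  have ht : |w.2 / (1 + w.1) - w'.2 / (1 + w'.1)| ≤ 1 := abs_le.2 ⟨by linarith, by linarith⟩
  unfold projDist; linarith

theorem abs_fst_sub_le {w w' : ℝ × ℝ} (hw : w ∈ Icc (0 : ℝ) 1 ×ˢ Icc (0 : ℝ) 1)
    (hw' : w' ∈ Icc (0 : ℝ) 1 ×ˢ Icc (0 : ℝ) 1) :
    |w.1 - w'.1| ≤ 4 * |1 / (1 + w.1) - 1 / (1 + w'.1)| := by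
  obtain ⟨⟨hu, hu1⟩, -⟩ := hw
  obtain ⟨⟨hu', hu1'⟩, -⟩ := hw'
  have e : w'.1 - w.1 = (1 + w.1) * (1 + w'.1) * (1 / (1 + w.1) - 1 / (1 + w'.1)) := by
    have : (1 + w.1) ≠ 0 := by linarith
    have : (1 + w'.1) ≠ 0 := by linarith
    field_simp; ring
  rw [abs_sub_comm, e, abs_mul, abs_of_nonneg (by nlinarith)]
  gcongr
  nlinarith

theorem abs_snd_sub_le_projDist {w w' : ℝ × ℝ} (hw : w ∈ Icc (0 : ℝ) 1 ×ˢ Icc (0 : ℝ) 1)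
    (hw' : w' ∈ Icc (0 : ℝ) 1 ×ˢ Icc (0 : ℝ) 1) : |w.2 - w'.2| ≤ 2 * projDist w w' := by
  have hx := abs_fst_sub_le hw hw'
  obtain ⟨-, h3, h4⟩ := projCoord_mem hw'
  obtain ⟨⟨hu, hu1⟩, -⟩ := hw
  obtain ⟨⟨hu', hu1'⟩, -⟩ := hw'
  have e : w.2 - w'.2 = (1 + w.1) * (w.2 / (1 + w.1) - w'.2 / (1 + w'.1)) +
      w'.2 / (1 + w'.1) * (w.1 - w'.1) := by
    have : (1 + w.1) ≠ 0 := by linarith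
    have : (1 + w'.1) ≠ 0 := by linarith
    field_simp; ring
  rw [e]
  refine (abs_add_le _ _).trans ?_
  rw [abs_mul, abs_mul, abs_of_nonneg (by linarith : 0 ≤ 1 + w.1), abs_of_nonneg h3]
  have h5 : (1 + w.1) * |w.2 / (1 + w.1) - w'.2 / (1 + w'.1)| ≤
      2 * |w.2 / (1 + w.1) - w'.2 / (1 + w'.1)| := by gcongr; linarith
  have h6 : w'.2 / (1 + w'.1) * |w.1 - w'.1| ≤ 1 * |w.1 - w'.1| := by gcongr
  have := abs_nonneg (1 / (1 + w.1) - 1 / (1 + w'.1))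
  unfold projDist; linarith

/-- A projective map of determinant `± 1` whose denominator is at least `3 / 2` contracts by
`4 / 9`. -/
theorem abs_projective_sub_le {p q e f s s' : ℝ} (hp : 1 ≤ p) (hq : 1 ≤ q) (hs : 1 / 2 ≤ s)
    (hs' : 1 / 2 ≤ s') (hdet : |e * p - f * q| = 1) :
    |(f + e * s) / (p + q * s) - (f + e * s') / (p + q * s')| ≤ 4 / 9 * |s - s'| := by
  have hD : 3 / 2 ≤ p + q * s := by nlinarith
  have hD' : 3 / 2 ≤ p + q * s' := by nlinarith
  have e1 : (f + e * s) / (p + q * s) - (f + e * s') / (p + q * s') =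
      (e * p - f * q) * (s - s') / ((p + q * s) * (p + q * s')) := by
    have : p + q * s ≠ 0 := by linarith
    have : p + q * s' ≠ 0 := by linarith
    field_simp; ring
  have h : 9 / 4 ≤ (p + q * s) * (p + q * s') := by nlinarith
  have h0 : 0 < (p + q * s) * (p + q * s') := by linarith
  rw [e1, abs_div, abs_mul, hdet, one_mul, abs_of_pos h0, div_le_iff₀ h0]
  have := mul_le_mul_of_nonneg_right h (abs_nonneg (s - s'))
  linarith

/-- A projective shear whose values lie in `[0, 1]`: since `q / (p + q s) ≤ 2`, the shear is bounded
uniformly in the coefficients. -/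
theorem abs_projective_shear_sub_le {p q l r σ s s' t t' : ℝ} (hp : 1 ≤ p) (hq : 1 ≤ q)
    (hl : 0 ≤ l) (hlq : l ≤ q) (hσ : |σ| = 1) (hs : 1 / 2 ≤ s) (hs' : 1 / 2 ≤ s')
    (hY : (r + l * s' + σ * t') / (p + q * s') ∈ Icc (0 : ℝ) 1) :
    |(r + l * s + σ * t) / (p + q * s) - (r + l * s' + σ * t') / (p + q * s')| ≤
      2 / 3 * |t - t'| + 4 * |s - s'| := by
  have hD : 3 / 2 ≤ p + q * s := by nlinarith
  have hD' : 3 / 2 ≤ p + q * s' := by nlinarith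
  have hDpos : 0 < p + q * s := by linarith
  have hqD : q ≤ 2 * (p + q * s) := by nlinarith
  set Y := (r + l * s' + σ * t') / (p + q * s') with hYdef
  have e1 : (r + l * s + σ * t) / (p + q * s) - Y =
      (l * (s - s') + σ * (t - t') - Y * q * (s - s')) / (p + q * s) := by
    have h1 : Y * (p + q * s') = r + l * s' + σ * t' := by
      rw [hYdef]; exact div_mul_cancel₀ _ (by linarith)
    rw [eq_div_iff hDpos.ne', sub_mul, div_mul_cancel₀ _ hDpos.ne']
    linear_combination -h1
  rw [e1, abs_div, abs_of_pos hDpos, div_le_iff₀ hDpos]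
  have h2 : |l * (s - s') + σ * (t - t') - Y * q * (s - s')| ≤
      l * |s - s'| + |t - t'| + q * |s - s'| := by
    refine (abs_sub _ _).trans (add_le_add ((abs_add_le _ _).trans_eq ?_) ?_)
    · rw [abs_mul, abs_mul, hσ, one_mul, abs_of_nonneg hl]
    · rw [abs_mul, abs_mul, abs_of_nonneg hY.1, abs_of_nonneg (by linarith : 0 ≤ q)]
      have : Y * q ≤ 1 * q := by gcongr; exact hY.2
      rw [one_mul] at this
      gcongr
  have h3 := mul_le_mul_of_nonneg_right (hlq.trans hqD) (abs_nonneg (s - s'))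
  have h4 := mul_le_mul_of_nonneg_right hqD (abs_nonneg (s - s'))
  have h5 := mul_le_mul_of_nonneg_right hD (abs_nonneg (t - t'))
  linarith

/-- In the coordinates `(s, η)` every inverse branch is again projective; `s` is contracted by
`4 / 9` and `η` by `2 / 3` up to a shear of size `4 |Δs|`. -/
theorem projDist_branch_le (b : Digit) {w w' : ℝ × ℝ} (hw : w ∈ Icc (0 : ℝ) 1 ×ˢ Icc (0 : ℝ) 1)
    (hw' : w' ∈ Icc (0 : ℝ) 1 ×ˢ Icc (0 : ℝ) 1) :
    projDist (branch b w) (branch b w') ≤ 2 / 3 * projDist w w' := by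
  obtain ⟨p, q, e, f, l, r, σ, hp, hq, hdet, hl, hlq, hσ, hform⟩ : ∃ p q e f l r σ : ℝ,
      1 ≤ p ∧ 1 ≤ q ∧ |e * p - f * q| = 1 ∧ 0 ≤ l ∧ l ≤ q ∧ |σ| = 1 ∧
      ∀ z ∈ Icc (0 : ℝ) 1 ×ˢ Icc (0 : ℝ) 1,
        1 / (1 + (branch b z).1) =
          (f + e * (1 / (1 + z.1))) / (p + q * (1 / (1 + z.1))) ∧
        (branch b z).2 / (1 + (branch b z).1) =
          (r + l * (1 / (1 + z.1)) + σ * (z.2 / (1 + z.1))) / (p + q * (1 / (1 + z.1))) := by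
    rcases b with ⟨n, a⟩ | ⟨n, a⟩ <;>
    have hn : (0 : ℝ) ≤ n := n.cast_nonneg <;>
    have ha : (0 : ℝ) ≤ a := a.cast_nonneg
    · refine ⟨1, n + a + 1, n + a, 1, a, 1, -1, le_rfl, by linarith, ?_, ha, by linarith,
        by simp, fun z hz => ?_⟩
      · rw [show ((n : ℝ) + a) * 1 - 1 * (n + a + 1) = -1 by ring]; simp
      · have hz1 := hz.1.1
        have h1 : 1 + z.1 ≠ 0 := by linarith
        have h2 : (n : ℝ) + a + 1 + z.1 ≠ 0 := by linarith
        have h3 : (n : ℝ) + a + 1 + z.1 + 1 ≠ 0 := by linarith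
        have h4 : 1 + z.1 + (n + a + 1) ≠ 0 := by linarith
        constructor <;> simp only [branch, branchDenom] <;> field_simp <;> ring
    · refine ⟨n + 2, 1 + (n + 2) * a, 1 + (n + 1) * a, n + 1, 0, 0, 1, by linarith,
        le_add_of_nonneg_right (by positivity), ?_, le_rfl, by positivity, by simp,
        fun z hz => ?_⟩
      · rw [show (1 + ((n : ℝ) + 1) * a) * (n + 2) - (n + 1) * (1 + (n + 2) * a) = 1 by ring]
        simp
      · have hz1 : 0 ≤ z.1 := hz.1.1
        have h1 : 1 + z.1 ≠ 0 := by linarith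
        have h2 : 1 + ((n : ℝ) + 1) * (a + 1 + z.1) ≠ 0 := by positivity
        have h3 : 1 + ((n : ℝ) + 1) * (a + 1 + z.1) + (a + 1 + z.1) ≠ 0 := by positivity
        have h4 : ((n : ℝ) + 2) * (1 + z.1) + (1 + (n + 2) * a) ≠ 0 := by positivity
        constructor <;> simp only [branch, branchDenom] <;> field_simp <;> ring
  have hY := (projCoord_mem (branch_mem_closedSquare b hw')).2
  rw [(hform w' hw').2] at hY
  have h1 := abs_projective_sub_le hp hq (projCoord_mem hw).1.1 (projCoord_mem hw').1.1 hdet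
  have h2 := abs_projective_shear_sub_le (t := w.2 / (1 + w.1)) hp hq hl hlq hσ
    (projCoord_mem hw).1.1 (projCoord_mem hw').1.1 hY
  unfold projDist
  rw [(hform w hw).1, (hform w hw).2, (hform w' hw').1, (hform w' hw').2]
  linarith

theorem branchDenom_le (b : Digit) {u u' : ℝ} (hu : 0 ≤ u) :
    branchDenom b u' ≤ branchDenom b u * Real.exp |u - u'| := by
  have h : branchDenom b u' ≤ branchDenom b u * (|u - u'| + 1) := by
    have h1 := neg_abs_le (u - u')
    have h0 := abs_nonneg (u - u')
    rcases b with ⟨n, a⟩ | ⟨n, a⟩ <;>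
    have hn : (0 : ℝ) ≤ n := n.cast_nonneg <;>
    have ha : (0 : ℝ) ≤ a := a.cast_nonneg <;>
    simp only [branchDenom]
    · have : 0 ≤ (n + a + u) * |u - u'| := by positivity
      linarith
    · have h2 : 0 ≤ (1 + (n + 1) * (a + u)) * |u - u'| := by positivity
      have h3 : 0 ≤ (n + 1) * (|u - u'| + (u - u')) := mul_nonneg (by linarith) (by linarith)
      linarith
  have h0 := branchDenom_pos b hu
  exact h.trans (by gcongr; exact Real.add_one_le_exp _)

theorem logLipschitz_branchJacobian (b : Digit) :
    LogLipschitz (fun z z' => projDist (squareCoe z) (squareCoe z')) 3 (branchJacobian b) := by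
  intro z z'
  have hx := abs_fst_sub_le (squareCoe_mem z) (squareCoe_mem z')
  have hD := branchDenom_le b (u := z.1) (u' := z'.1) z.1.2.1
  have h0 := branchDenom_pos b z.1.2.1
  have h0' := branchDenom_pos b z'.1.2.1
  have hexp : Real.exp (3 * |(z.1 : ℝ) - z'.1|) = Real.exp |(z.1 : ℝ) - z'.1| ^ 3 := by
    rw [← Real.exp_nat_mul]; norm_num
  unfold branchJacobian
  rw [← ENNReal.ofReal_mul (Real.exp_nonneg _)]
  refine ENNReal.ofReal_le_ofReal ?_
  calc 1 / branchDenom b z.1 ^ 3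
      ≤ Real.exp (3 * |(z.1 : ℝ) - z'.1|) * (1 / branchDenom b z'.1 ^ 3) := by
        rw [mul_one_div, div_le_div_iff₀ (by positivity) (by positivity), one_mul, hexp,
          mul_comm, ← mul_pow]
        gcongr
    _ ≤ _ := by
        gcongr
        refine hx.trans ?_
        unfold projDist
        have := abs_nonneg (1 / (1 + (squareCoe z).1) - 1 / (1 + (squareCoe z').1))
        have := abs_nonneg ((squareCoe z).2 / (1 + (squareCoe z).1) -
          (squareCoe z').2 / (1 + (squareCoe z').1))
        linarith

theorem hasBoundedDistortion_squareBranch :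
    HasBoundedDistortion squareBranch branchJacobian
      (fun z z' => projDist (squareCoe z) (squareCoe z')) 3 10 where
  const_nonneg := by norm_num
  nonneg _ _ := projDist_nonneg _ _
  le_diam z z' := projDist_le (squareCoe_mem z) (squareCoe_mem z')
  contract b z z' := by
    rw [squareCoe_squareBranch, squareCoe_squareBranch]
    exact projDist_branch_le b (squareCoe_mem z) (squareCoe_mem z')
  jacobian := logLipschitz_branchJacobian

theorem edist_le_projDist (z z' : unitInterval × unitInterval) :
    edist z z' ≤ ENNReal.ofReal (2 * projDist (squareCoe z) (squareCoe z')) := by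
  rw [edist_dist]
  refine ENNReal.ofReal_le_ofReal (max_le ?_ ?_)
  · refine (abs_fst_sub_le (squareCoe_mem z) (squareCoe_mem z')).trans ?_
    unfold projDist
    have := abs_nonneg (1 / (1 + (squareCoe z).1) - 1 / (1 + (squareCoe z').1))
    have := abs_nonneg ((squareCoe z).2 / (1 + (squareCoe z).1) -
      (squareCoe z').2 / (1 + (squareCoe z').1))
    linarith
  · exact abs_snd_sub_le_projDist (squareCoe_mem z) (squareCoe_mem z')

/-! ### Measurability of the fast map -/

theorem measurableEmbedding_squareCoe : MeasurableEmbedding squareCoe :=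
  (MeasurableEmbedding.subtype_coe measurableSet_Icc).prodMap
    (MeasurableEmbedding.subtype_coe measurableSet_Icc)

theorem measurable_slowMap : Measurable slowMap := by
  rw [← measurableEmbedding_squareCoe.measurable_comp_iff]
  have h : squareCoe ∘ slowMap = fun p : unitInterval × unitInterval =>
      if (p.1 : ℝ) = 0 then ((p.1 : ℝ), (p.2 : ℝ))
      else if 1 - (p.1 : ℝ) ≤ p.2 then (Int.fract (1 / (p.1 : ℝ)), (1 - (p.2 : ℝ)) / p.1)
      else (Int.fract (1 / (1 - (p.1 : ℝ))), (p.2 : ℝ) / (1 - p.1)) := by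
    funext p
    simp only [Function.comp, slowMap]
    split_ifs <;> rfl
  rw [h]
  have h1 : Measurable fun p : unitInterval × unitInterval => (p.1 : ℝ) := by fun_prop
  have h2 : Measurable fun p : unitInterval × unitInterval => (p.2 : ℝ) := by fun_prop
  refine Measurable.ite (h1 (measurableSet_singleton 0)) (h1.prodMk h2) <|
    Measurable.ite (measurableSet_le (measurable_const.sub h1) h2) ?_ ?_
  · exact ((measurable_const.div h1).fract).prodMk ((measurable_const.sub h2).div h1)
  · exact ((measurable_const.div (measurable_const.sub h1)).fract).prodMk
      (h2.div (measurable_const.sub h1))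

theorem measurableSet_stopSet : MeasurableSet stopSet := by
  have h1 : Measurable fun p : unitInterval × unitInterval => (p.1 : ℝ) := by fun_prop
  have h2 : Measurable fun p : unitInterval × unitInterval => (p.2 : ℝ) := by fun_prop
  exact (measurableSet_le (measurable_const.sub h1) h2).union (measurableSet_lt measurable_const h1)

theorem measurable_entryTime : Measurable entryTime := by
  classical
  have hm (k : ℕ) : MeasurableSet {p | slowMap^[k] p ∈ stopSet} :=
    measurable_slowMap.iterate k measurableSet_stopSet
  have hex : MeasurableSet {p | ∃ n, slowMap^[n] p ∈ stopSet} := by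
    rw [ofPred_exists]; exact .iUnion hm
  refine measurable_to_nat fun p₀ => ?_
  generalize entryTime p₀ = n
  -- The infimum over the empty set is `0`, so the level set of `0` has a second part.
  have h (n : ℕ) : entryTime ⁻¹' {n} = {p | (slowMap^[n] p ∈ stopSet ∧
      ∀ k < n, slowMap^[k] p ∉ stopSet) ∨ (n = 0 ∧ ¬ ∃ k, slowMap^[k] p ∈ stopSet)} := by
    ext p
    simp only [mem_preimage, mem_singleton_iff, mem_ofPred_eq]
    by_cases hp : ∃ k, slowMap^[k] p ∈ stopSet
    · rw [entryTime, Nat.sInf_def (s := {k | slowMap^[k] p ∈ stopSet}) hp, Nat.find_eq_iff]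
      simp [hp]
    · have h0 : entryTime p = 0 := by
        rw [entryTime, Nat.sInf_eq_zero]
        exact .inr (eq_empty_iff_forall_notMem.2 fun k hk => hp ⟨k, hk⟩)
      push Not at hp
      simp [h0, hp, eq_comm]
  rw [h]
  refine .union (.inter (hm _) ?_) (.inter (.const _) hex.compl)
  have hall : {p | ∀ k < n, slowMap^[k] p ∉ stopSet} =
      ⋂ k, ⋂ _ : k < n, {p | slowMap^[k] p ∈ stopSet}ᶜ := by
    ext p; simp
  change MeasurableSet {p | ∀ k < n, slowMap^[k] p ∉ stopSet}
  rw [hall]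
  exact .iInter fun k => .iInter fun _ => (hm k).compl

theorem measurable_fastMap : Measurable fastMap := by
  have h : Measurable fun q : ℕ × (unitInterval × unitInterval) => slowMap^[q.1 + 1] q.2 :=
    measurable_from_prod_countable_right fun n => measurable_slowMap.iterate (n + 1)
  exact h.comp (measurable_entryTime.prodMk measurable_id)

/-! ### The fast map inverts its branches -/

/-- The open unit square in the plane. -/
def openSquare : Set (ℝ × ℝ) := Ioo 0 1 ×ˢ Ioo 0 1

theorem measurableSet_openSquare : MeasurableSet openSquare :=
  measurableSet_Ioo.prod measurableSet_Ioo

theorem openSquare_subset : openSquare ⊆ Icc (0 : ℝ) 1 ×ˢ Icc (0 : ℝ) 1 :=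
  prod_mono Ioo_subset_Icc_self Ioo_subset_Icc_self

/-- The number of red steps with digit `1` that a branch starts with. -/
def Digit.shifts : Digit → ℕ := Sum.elim Prod.fst Prod.fst

/-- The branch preceded by one more red step with digit `1`. -/
def Digit.shift : Digit → Digit
  | .inl (n, a) => .inl (n + 1, a)
  | .inr (n, a) => .inr (n + 1, a)

theorem branch_shift (b : Digit) {w : ℝ × ℝ} (hw : 0 ≤ w.1) :
    branch b.shift w =
      ((branch b w).1 / (1 + (branch b w).1), (branch b w).2 / (1 + (branch b w).1)) := by
  have h0 := branchDenom_pos b hw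
  have hs := branchDenom_pos b.shift hw
  have e : branchDenom b.shift w.1 = branchDenom b w.1 * (1 + (branch b w).1) := by
    rw [mul_add, mul_one]
    rcases b with ⟨n, a⟩ | ⟨n, a⟩ <;> simp only [branch, Digit.shift] <;>
      rw [mul_div_cancel₀ _ (by linarith)] <;> simp only [branchDenom] <;> push_cast <;> ring
  have hx : 1 + (branch b w).1 ≠ 0 := fun h => by rw [h, mul_zero] at e; linarith
  rcases b with ⟨n, a⟩ | ⟨n, a⟩ <;> refine Prod.ext ?_ ?_ <;>
    simp only [Digit.shift] at e ⊢ <;> simp only [branch] at e hx ⊢ <;> rw [e, div_div]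

theorem branch_mem_openSquare (b : Digit) {w : ℝ × ℝ} (hw : w ∈ openSquare) :
    branch b w ∈ openSquare := by
  obtain ⟨⟨hu, hu1⟩, hv, hv1⟩ := hw
  have hD := branchDenom_pos b hu.le
  have hD0 : 0 < branchDenom b w.1 := by linarith
  rcases b with ⟨n, a⟩ | ⟨n, a⟩ <;>
  have hn : (0 : ℝ) ≤ n := n.cast_nonneg <;>
  have ha : (0 : ℝ) ≤ a := a.cast_nonneg
  · refine ⟨⟨div_pos one_pos hD0, (div_lt_one hD0).2 ?_⟩,
      div_pos (by linarith) hD0, (div_lt_one hD0).2 ?_⟩ <;>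
    simp only [branchDenom] <;> linarith
  · have h : 0 ≤ n * (a + 1 + w.1) := by positivity
    refine ⟨⟨div_pos (by positivity) hD0, (div_lt_one hD0).2 ?_⟩,
      div_pos hv hD0, (div_lt_one hD0).2 (by linarith)⟩
    simp only [branchDenom]; linarith

theorem slowMap_of_shift {p q : unitInterval × unitInterval} (hq : squareCoe q ∈ openSquare)
    (hp : squareCoe p = ((q.1 : ℝ) / (1 + q.1), (q.2 : ℝ) / (1 + q.1))) :
    slowMap p = q ∧ p ∉ stopSet := by
  obtain ⟨⟨hx, hx1⟩, hy, hy1⟩ := hq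
  change 0 < (q.1 : ℝ) at hx; change (q.1 : ℝ) < 1 at hx1
  change 0 < (q.2 : ℝ) at hy; change (q.2 : ℝ) < 1 at hy1
  have hp1 : (p.1 : ℝ) = q.1 / (1 + q.1) := congrArg Prod.fst hp
  have hp2 : (p.2 : ℝ) = q.2 / (1 + q.1) := congrArg Prod.snd hp
  have hpos : 0 < 1 + (q.1 : ℝ) := by linarith
  have e : 1 - (p.1 : ℝ) = 1 / (1 + q.1) := by rw [hp1]; field_simp; ring
  have h0 : (p.1 : ℝ) ≠ 0 := by rw [hp1]; positivity
  have hlt : ¬ 1 - (p.1 : ℝ) ≤ p.2 := by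
    rw [e, hp2, not_le]; gcongr
  refine ⟨?_, ?_⟩
  · rw [slowMap, if_neg h0, dif_neg hlt]
    refine Prod.ext (Subtype.ext ?_) (Subtype.ext ?_)
    · change Int.fract (1 / (1 - (p.1 : ℝ))) = q.1
      rw [e, one_div_one_div, Int.fract_one_add, Int.fract_eq_self.2 ⟨hx.le, hx1⟩]
    · change (p.2 : ℝ) / (1 - p.1) = q.2
      rw [e, hp2]; field_simp
  · rintro (h | h)
    · exact hlt h
    · rw [hp1, lt_div_iff₀ hpos] at h; linarith

theorem slowMap_of_green {p q : unitInterval × unitInterval} (hq : squareCoe q ∈ openSquare)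
    (a : ℕ) (hp : squareCoe p = branch (.inl (0, a)) (squareCoe q)) :
    slowMap p = q ∧ p ∈ stopSet := by
  obtain ⟨⟨hx, hx1⟩, hy, hy1⟩ := hq
  change 0 < (q.1 : ℝ) at hx; change (q.1 : ℝ) < 1 at hx1
  change 0 < (q.2 : ℝ) at hy; change (q.2 : ℝ) < 1 at hy1
  have hp1 : (p.1 : ℝ) = 1 / (((0 : ℕ) : ℝ) + a + 1 + q.1) := congrArg Prod.fst hp
  have hp2 : (p.2 : ℝ) = (a + 1 + q.1 - q.2) / (((0 : ℕ) : ℝ) + a + 1 + q.1) :=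
    congrArg Prod.snd hp
  rw [Nat.cast_zero, zero_add] at hp1 hp2
  have hpos : 0 < (a : ℝ) + 1 + q.1 := by positivity
  have h0 : (p.1 : ℝ) ≠ 0 := by rw [hp1]; positivity
  have e : 1 - (p.2 : ℝ) = q.2 / (a + 1 + q.1) := by rw [hp2]; field_simp; ring
  have hle : 1 - (p.1 : ℝ) ≤ p.2 := by
    have : (q.2 : ℝ) / (a + 1 + q.1) ≤ 1 / (a + 1 + q.1) := by gcongr
    linarith
  refine ⟨?_, .inl hle⟩
  rw [slowMap, if_neg h0, dif_pos hle]
  refine Prod.ext (Subtype.ext ?_) (Subtype.ext ?_)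
  · change Int.fract (1 / (p.1 : ℝ)) = q.1
    rw [hp1, one_div_one_div, ← Nat.cast_succ, Int.fract_natCast_add,
      Int.fract_eq_self.2 ⟨hx.le, hx1⟩]
  · change (1 - (p.2 : ℝ)) / p.1 = q.2
    rw [e, hp1]; field_simp

theorem slowMap_of_red {p q : unitInterval × unitInterval} (hq : squareCoe q ∈ openSquare)
    (a : ℕ) (hp : squareCoe p = branch (.inr (0, a)) (squareCoe q)) :
    slowMap p = q ∧ p ∈ stopSet := by
  obtain ⟨⟨hx, hx1⟩, hy, hy1⟩ := hq
  change 0 < (q.1 : ℝ) at hx; change (q.1 : ℝ) < 1 at hx1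
  change 0 < (q.2 : ℝ) at hy; change (q.2 : ℝ) < 1 at hy1
  have hD : 1 + (((0 : ℕ) : ℝ) + 1) * (a + 1 + q.1) = (a + 2 : ℕ) + q.1 := by push_cast; ring
  have hp1 : (p.1 : ℝ) = (a + 1 + q.1) / (1 + (((0 : ℕ) : ℝ) + 1) * (a + 1 + q.1)) :=
    congrArg Prod.fst hp
  have hp2 : (p.2 : ℝ) = q.2 / (1 + (((0 : ℕ) : ℝ) + 1) * (a + 1 + q.1)) :=
    congrArg Prod.snd hp
  rw [hD] at hp1 hp2
  have hpos : 0 < ((a + 2 : ℕ) : ℝ) + q.1 := by positivity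
  have h0 : (p.1 : ℝ) ≠ 0 := by rw [hp1]; positivity
  have e : 1 - (p.1 : ℝ) = 1 / ((a + 2 : ℕ) + q.1) := by
    rw [hp1]; field_simp; push_cast; ring
  have hlt : ¬ 1 - (p.1 : ℝ) ≤ p.2 := by
    rw [e, hp2, not_le]; gcongr
  refine ⟨?_, .inr ?_⟩
  · rw [slowMap, if_neg h0, dif_neg hlt]
    refine Prod.ext (Subtype.ext ?_) (Subtype.ext ?_)
    · change Int.fract (1 / (1 - (p.1 : ℝ))) = q.1
      rw [e, one_div_one_div, Int.fract_natCast_add, Int.fract_eq_self.2 ⟨hx.le, hx1⟩]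
    · change (p.2 : ℝ) / (1 - p.1) = q.2
      rw [e, hp2]; field_simp
  · have ha : (0 : ℝ) ≤ a := a.cast_nonneg
    rw [hp1, lt_div_iff₀ hpos]; push_cast; linarith

/-- Along an inverse branch the slow map first enters the stop set after exactly as many steps as
the branch records, and one further step inverts the branch. -/
theorem isLeast_entry_squareBranch (b : Digit) {q : unitInterval × unitInterval}
    (hq : squareCoe q ∈ openSquare) :
    IsLeast {k | slowMap^[k] (squareBranch b q) ∈ stopSet} b.shifts ∧
      slowMap^[b.shifts + 1] (squareBranch b q) = q := by
  have hstart {b : Digit} (h0 : b.shifts = 0)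
      (h : slowMap (squareBranch b q) = q ∧ squareBranch b q ∈ stopSet) :
      IsLeast {k | slowMap^[k] (squareBranch b q) ∈ stopSet} b.shifts ∧
        slowMap^[b.shifts + 1] (squareBranch b q) = q := by
    rw [h0]
    exact ⟨⟨h.2, fun _ _ => Nat.zero_le _⟩, h.1⟩
  have hstep {b : Digit} (h : IsLeast {k | slowMap^[k] (squareBranch b q) ∈ stopSet} b.shifts ∧
      slowMap^[b.shifts + 1] (squareBranch b q) = q) :
      IsLeast {k | slowMap^[k] (squareBranch b.shift q) ∈ stopSet} b.shift.shifts ∧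
        slowMap^[b.shift.shifts + 1] (squareBranch b.shift q) = q := by
    have hs : b.shift.shifts = b.shifts + 1 := by rcases b with b | b <;> rfl
    have hcoe := squareCoe_squareBranch b q
    obtain ⟨hmap, hentry⟩ := slowMap_of_shift (p := squareBranch b.shift q)
      (q := squareBranch b q) (hcoe ▸ branch_mem_openSquare b hq) <| by
        rw [squareCoe_squareBranch, branch_shift b hq.1.1.le, ← hcoe]; rfl
    rw [hs, Function.iterate_succ_apply, hmap]
    refine ⟨⟨?_, fun k hk => ?_⟩, h.2⟩
    · rw [mem_ofPred_eq, Function.iterate_succ_apply, hmap]; exact h.1.1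
    · cases k with
      | zero => exact absurd hk hentry
      | succ k =>
        rw [mem_ofPred_eq, Function.iterate_succ_apply, hmap] at hk
        exact Nat.succ_le_succ (h.1.2 hk)
  rcases b with ⟨n, a⟩ | ⟨n, a⟩
  · induction n with
    | zero =>
      exact hstart (b := .inl (0, a)) rfl
        (slowMap_of_green hq a (squareCoe_squareBranch (.inl (0, a)) q))
    | succ n ih => exact hstep (b := .inl (n, a)) ih
  · induction n with
    | zero =>
      exact hstart (b := .inr (0, a)) rfl
        (slowMap_of_red hq a (squareCoe_squareBranch (.inr (0, a)) q))
    | succ n ih => exact hstep (b := .inr (n, a)) ih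

theorem fastMap_squareBranch (b : Digit) {q : unitInterval × unitInterval}
    (hq : squareCoe q ∈ openSquare) : fastMap (squareBranch b q) = q := by
  obtain ⟨h1, h2⟩ := isLeast_entry_squareBranch b hq
  rw [fastMap, entryTime, h1.csInf_eq, h2]

theorem squareProj_branch (b : Digit) {w : ℝ × ℝ} (hw : w ∈ openSquare) :
    squareProj (branch b w) = squareBranch b (squareProj w) := by
  rw [squareBranch, squareCoe_squareProj (openSquare_subset hw)]

/-- The branches are injective with disjoint images: the dynamics recovers the point and the number
of shifts, and the remaining data can be read off the coordinates. -/
theorem eq_of_branch_eq {b b' : Digit} {w w' : ℝ × ℝ} (hw : w ∈ openSquare)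
    (hw' : w' ∈ openSquare) (h : branch b w = branch b' w') : w = w' ∧ b = b' := by
  have hp := squareCoe_squareProj (openSquare_subset hw)
  have hp' := squareCoe_squareProj (openSquare_subset hw')
  have hsq : squareBranch b (squareProj w) = squareBranch b' (squareProj w') := by
    rw [← squareProj_branch b hw, ← squareProj_branch b' hw', h]
  have hb := isLeast_entry_squareBranch b (hp.symm ▸ hw)
  have hb' := isLeast_entry_squareBranch b' (hp'.symm ▸ hw')
  rw [hsq] at hb
  have hn : b.shifts = b'.shifts := hb.1.unique hb'.1
  have hww : w = w' := by
    have h1 := hb.2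
    rw [hn, hb'.2] at h1
    rw [← hp, ← hp', h1]
  refine ⟨hww, ?_⟩
  subst hww
  obtain ⟨⟨hu, -⟩, -, hv1⟩ := hw
  have hD := branchDenom_pos b hu.le
  have hD' := branchDenom_pos b' hu.le
  have hD0 : branchDenom b w.1 ≠ 0 := by linarith
  have hD0' : branchDenom b' w.1 ≠ 0 := by linarith
  -- A green and a red branch after `n` shifts are separated by the line `y + (n + 1) x = 1`.
  have hsep {n a a' : ℕ} : branch (.inl (n, a)) w ≠ branch (.inr (n, a')) w := by
    intro h
    have h0 := branchDenom_pos (.inl (n, a)) hu.le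
    have h0' := branchDenom_pos (.inr (n, a')) hu.le
    have h1 : (branch (.inl (n, a)) w).2 + (n + 1) * (branch (.inl (n, a)) w).1 =
        1 + (1 - w.2) / branchDenom (.inl (n, a)) w.1 := by
      simp only [branch]; field_simp; simp only [branchDenom]; ring
    have h2 : (branch (.inr (n, a')) w).2 + (n + 1) * (branch (.inr (n, a')) w).1 =
        1 - (1 - w.2) / branchDenom (.inr (n, a')) w.1 := by
      simp only [branch]; field_simp; simp only [branchDenom]; ring
    rw [h, h2] at h1
    have h3 : 0 < (1 - w.2) / branchDenom (.inl (n, a)) w.1 :=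
      div_pos (by linarith) (by linarith)
    have h4 : 0 < (1 - w.2) / branchDenom (.inr (n, a')) w.1 :=
      div_pos (by linarith) (by linarith)
    linarith
  rcases b with ⟨n, a⟩ | ⟨n, a⟩ <;> rcases b' with ⟨n', a'⟩ | ⟨n', a'⟩ <;>
    obtain rfl : n = n' := hn
  · have h1 := congrArg Prod.fst h
    simp only [branch] at h1
    rw [div_eq_div_iff hD0 hD0'] at h1
    simp only [branchDenom] at h1
    have : (a : ℝ) = a' := by linarith
    rw [Nat.cast_injective this]
  · exact absurd h hsep
  · exact absurd h.symm hsep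
  · have h1 := congrArg Prod.fst h
    simp only [branch] at h1
    rw [div_eq_div_iff hD0 hD0'] at h1
    simp only [branchDenom] at h1
    have : (a : ℝ) = a' := by linarith
    rw [Nat.cast_injective this]

/-! ### The branches fill the square up to a null set -/

/-- The points of the open square with irrational abscissa that avoid the lines
`y = 1 - n x`; these lines carry the boundaries of the images of the branches. -/
def regularSet : Set (ℝ × ℝ) :=
  {z | z ∈ openSquare ∧ Irrational z.1 ∧ ∀ n : ℕ, z.2 ≠ 1 - n * z.1}

/-- A regular point either lies in the stop set, where one slow step inverts a branch, or is mapped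
by a red step with digit `1` to a regular point whose reciprocal abscissa is smaller by `1`. -/
theorem exists_branch_eq {z : ℝ × ℝ} (hz : z ∈ regularSet) :
    ∃ b, ∃ w ∈ openSquare, branch b w = z := by
  obtain ⟨m, hm⟩ : ∃ m : ℕ, 1 < m * z.1 := by
    obtain ⟨m, hm⟩ := exists_nat_gt (1 / z.1)
    exact ⟨m, (div_lt_iff₀ hz.1.1.1).1 hm⟩
  induction m generalizing z with
  | zero => norm_num at hm
  | succ m ih =>
    obtain ⟨⟨⟨hx, hx1⟩, hy, hy1⟩, hirr, hline⟩ := hz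
    have hfract {x : ℝ} (hx : Irrational x) : Int.fract x ∈ Ioo (0 : ℝ) 1 := by
      refine ⟨Int.fract_pos.2 fun h => ?_, Int.fract_lt_one x⟩
      exact hx.ne_int _ h
    have hline1 : z.2 ≠ 1 - z.1 := by simpa using hline 1
    rcases lt_or_gt_of_ne hline1 with hlt | hgt
    · have hx0 : 0 < 1 - z.1 := by linarith
      have hirr' : Irrational (1 - z.1) := by simpa using hirr.ratCast_sub 1
      have hhalf : z.1 ≠ 1 / 2 := by
        have := hirr.ne_rational 1 2
        simpa using this
      rcases lt_or_gt_of_ne hhalf with hlo | hhi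
      · -- A red step with digit `1` comes first; it is inverted and the induction applies.
        have hirr'' : Irrational (z.1 / (1 - z.1)) := by
          have e : z.1 / (1 - z.1) = (1 - z.1)⁻¹ - 1 := by
            rw [eq_sub_iff_add_eq, div_add_one hx0.ne', add_sub_cancel, one_div]
          rw [e]
          simpa using hirr'.inv.sub_ratCast 1
        have hline' (n : ℕ) : z.2 / (1 - z.1) ≠ 1 - n * (z.1 / (1 - z.1)) := fun hn => by
          rw [div_eq_iff hx0.ne', sub_mul, mul_assoc, div_mul_cancel₀ _ hx0.ne'] at hn
          refine hline (n + 1) ?_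
          push_cast; linarith
        have hm' : 1 < m * (z.1 / (1 - z.1)) := by
          rw [← mul_div_assoc, lt_div_iff₀ hx0]
          push_cast at hm; linarith
        obtain ⟨b, w, hw, hbw⟩ := ih (z := (z.1 / (1 - z.1), z.2 / (1 - z.1)))
          ⟨⟨⟨div_pos hx hx0, (div_lt_one hx0).2 (by linarith)⟩,
            div_pos hy hx0, (div_lt_one hx0).2 hlt⟩, hirr'', hline'⟩ hm'
        refine ⟨b.shift, w, hw, ?_⟩
        rw [branch_shift b hw.1.1.le, hbw]
        have h1 : 1 - z.1 ≠ 0 := hx0.ne'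
        refine Prod.ext ?_ ?_ <;> simp only <;> field_simp <;> simp
      · have hfl : 2 ≤ ⌊1 / (1 - z.1)⌋₊ :=
          Nat.le_floor ((le_div_iff₀ hx0).2 (by push_cast; linarith))
        obtain ⟨a, ha⟩ := Nat.exists_eq_add_of_le' hfl
        have hsum : (a : ℝ) + 2 + Int.fract (1 / (1 - z.1)) = 1 / (1 - z.1) := by
          have := Int.floor_add_fract (1 / (1 - z.1))
          rw [← natCast_floor_eq_intCast_floor (by positivity), ha] at this
          push_cast at this; exact this
        refine ⟨.inr (0, a), (Int.fract (1 / (1 - z.1)), z.2 / (1 - z.1)),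
          ⟨hfract (by simpa using hirr'.inv), div_pos hy hx0, (div_lt_one hx0).2 hlt⟩, ?_⟩
        have hD : branchDenom (.inr (0, a)) (Int.fract (1 / (1 - z.1))) = 1 / (1 - z.1) := by
          simp only [branchDenom]; push_cast; linarith
        refine Prod.ext ?_ ?_ <;> simp only [branch] <;> rw [hD]
        · rw [show (a : ℝ) + 1 + Int.fract (1 / (1 - z.1)) = 1 / (1 - z.1) - 1 by linarith]
          field_simp; ring
        · field_simp
    · have hfl : 1 ≤ ⌊1 / z.1⌋₊ :=
        Nat.le_floor ((le_div_iff₀ hx).2 (by push_cast; linarith))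
      obtain ⟨a, ha⟩ := Nat.exists_eq_add_of_le' hfl
      have hsum : (a : ℝ) + 1 + Int.fract (1 / z.1) = 1 / z.1 := by
        have := Int.floor_add_fract (1 / z.1)
        rw [← natCast_floor_eq_intCast_floor (by positivity), ha] at this
        push_cast at this; exact this
      refine ⟨.inl (0, a), (Int.fract (1 / z.1), (1 - z.2) / z.1),
        ⟨hfract (by simpa using hirr.inv), div_pos (by linarith) hx,
          (div_lt_one hx).2 (by linarith)⟩, ?_⟩
      have hD : branchDenom (.inl (0, a)) (Int.fract (1 / z.1)) = 1 / z.1 := by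
        simp only [branchDenom]; push_cast; linarith
      refine Prod.ext ?_ ?_ <;> simp only [branch] <;> rw [hD]
      · field_simp
      · rw [hsum]; field_simp; ring

theorem ae_mem_regularSet :
    ∀ᵐ z ∂(volume.restrict openSquare : Measure (ℝ × ℝ)), z ∈ regularSet := by
  have h1 : ∀ᵐ z : ℝ × ℝ, Irrational z.1 := by
    have h : ∀ᵐ x : ℝ, Irrational x := (countable_range ((↑) : ℚ → ℝ)).ae_notMem volume
    exact Measure.quasiMeasurePreserving_fst.ae h
  have h2 (n : ℕ) : ∀ᵐ z : ℝ × ℝ, z.2 ≠ 1 - n * z.1 := by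
    have hm : MeasurableSet {z : ℝ × ℝ | z.2 ≠ 1 - n * z.1} :=
      (measurableSet_eq_fun (by fun_prop) (by fun_prop)).compl
    refine (Measure.ae_prod_mem_iff_ae_ae_mem hm).2 (.of_forall fun x => ?_)
    exact (countable_singleton (1 - n * x)).ae_notMem volume
  filter_upwards [ae_restrict_mem measurableSet_openSquare, ae_restrict_of_ae h1,
    ae_restrict_of_ae (ae_all_iff.2 h2)] with z h h' h''
  exact ⟨h, h', h''⟩

/-! ### Change of variables -/

theorem hasDerivAt_branchDenom (b : Digit) (u : ℝ) :
    HasDerivAt (branchDenom b) (match b with | .inl _ => 1 | .inr (n, _) => n + 1) u := by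
  rcases b with ⟨n, a⟩ | ⟨n, a⟩
  · exact (hasDerivAt_id u).const_add _
  · have h := (((hasDerivAt_id u).const_add ((a : ℝ) + 1)).const_mul ((n : ℝ) + 1)).const_add 1
    rw [mul_one] at h
    exact h

/-- A fractional skew product `(x, y) ↦ (r x / D x, (l x + σ y) / D x)` has triangular
derivative. -/
theorem hasFDerivAt_skew {D r l : ℝ → ℝ} {D' r' l' σ : ℝ} {w : ℝ × ℝ}
    (hD : HasDerivAt D D' w.1) (hr : HasDerivAt r r' w.1) (hl : HasDerivAt l l' w.1)
    (h0 : D w.1 ≠ 0) : ∃ L : ℝ × ℝ →L[ℝ] ℝ × ℝ,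
      HasFDerivAt (fun z : ℝ × ℝ => (r z.1 / D z.1, (l z.1 + σ * z.2) / D z.1)) L w ∧
        L.det = (r' * D w.1 - r w.1 * D') * σ / D w.1 ^ 3 := by
  have hx := (hr.div hD h0).comp_hasFDerivAt w (hasFDerivAt_fst (𝕜 := ℝ) (p := w))
  have hy := ((hl.comp_hasFDerivAt w (hasFDerivAt_fst (𝕜 := ℝ) (p := w))).add
    ((hasFDerivAt_snd (𝕜 := ℝ) (p := w)).const_mul σ)).mul
    ((hD.inv h0).comp_hasFDerivAt w (hasFDerivAt_fst (𝕜 := ℝ) (p := w)))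
  refine ⟨LinearMap.toContinuousLinearMap (Matrix.toLin (Module.Basis.finTwoProd ℝ)
    (Module.Basis.finTwoProd ℝ) !![(r' * D w.1 - r w.1 * D') / D w.1 ^ 2, 0;
      (l w.1 + σ * w.2) * (-D' / D w.1 ^ 2) + (D w.1)⁻¹ * l', (D w.1)⁻¹ * σ]), ?_, ?_⟩
  · rw [Matrix.toLin_finTwoProd_toContinuousLinearMap]
    convert! hx.prodMk hy using 2
    · simp
    · ext <;> simp
  · rw [LinearMap.det_toContinuousLinearMap, LinearMap.det_toLin, Matrix.det_fin_two_of]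
    field_simp
    ring

theorem hasFDerivAt_branch (b : Digit) {w : ℝ × ℝ} (hw : 0 ≤ w.1) :
    ∃ L : ℝ × ℝ →L[ℝ] ℝ × ℝ, HasFDerivAt (branch b) L w ∧
      |L.det| = 1 / branchDenom b w.1 ^ 3 := by
  have h1 := branchDenom_pos b hw
  have h0 : branchDenom b w.1 ≠ 0 := by linarith
  have hD := hasDerivAt_branchDenom b w.1
  have habs : |branchDenom b w.1| = branchDenom b w.1 := abs_of_nonneg (by linarith)
  rcases b with ⟨n, a⟩ | ⟨n, a⟩
  · obtain ⟨L, hL, hdet⟩ := hasFDerivAt_skew (σ := -1) hD (hasDerivAt_const w.1 (1 : ℝ))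
      ((hasDerivAt_id w.1).const_add ((a : ℝ) + 1)) h0
    refine ⟨L, ?_, ?_⟩
    · refine hL.congr_of_eventuallyEq (.of_forall fun z => ?_)
      simp [branch, sub_eq_add_neg]
    · rw [hdet, abs_div, abs_pow, habs]; simp
  · obtain ⟨L, hL, hdet⟩ := hasFDerivAt_skew (σ := 1) hD
      ((hasDerivAt_id w.1).const_add ((a : ℝ) + 1)) (hasDerivAt_const w.1 (0 : ℝ)) h0
    refine ⟨L, ?_, ?_⟩
    · refine hL.congr_of_eventuallyEq (.of_forall fun z => ?_)
      simp [branch]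
    · rw [hdet, abs_div, abs_pow, habs]
      congr 1
      simp only [branchDenom, id]
      ring_nf
      simp

theorem measurable_branch (b : Digit) : Measurable (branch b) := by
  have hD : Measurable (branchDenom b) := by
    rcases b with ⟨n, a⟩ | ⟨n, a⟩ <;> unfold branchDenom <;> fun_prop
  rcases b with ⟨n, a⟩ | ⟨n, a⟩ <;> unfold branch <;> fun_prop

theorem injOn_branch (b : Digit) : InjOn (branch b) openSquare := fun _ hw _ hw' h =>
  (eq_of_branch_eq hw hw' h).1

theorem lintegral_image_branch (b : Digit) (f : ℝ × ℝ → ℝ≥0∞) :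
    ∫⁻ z in branch b '' openSquare, f z =
      ∫⁻ w in openSquare, ENNReal.ofReal (1 / branchDenom b w.1 ^ 3) * f (branch b w) := by
  have h (w : ℝ × ℝ) : ∃ L : ℝ × ℝ →L[ℝ] ℝ × ℝ, w ∈ openSquare →
      HasFDerivAt (branch b) L w ∧ |L.det| = 1 / branchDenom b w.1 ^ 3 := by
    by_cases hw : w ∈ openSquare
    · obtain ⟨L, hL⟩ := hasFDerivAt_branch b hw.1.1.le
      exact ⟨L, fun _ => hL⟩
    · exact ⟨0, fun h => absurd h hw⟩
  choose L hL using h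
  rw [lintegral_image_eq_lintegral_abs_det_fderiv_mul volume measurableSet_openSquare
    (fun w hw => (hL w hw).1.hasFDerivWithinAt) (injOn_branch b)]
  exact setLIntegral_congr_fun measurableSet_openSquare fun w hw => by
    simp only [(hL w hw).2]

/-- The images of the branches partition the square up to a null set, so integrals over the square
split into their pull-backs along the branches. -/
theorem lintegral_openSquare_eq_tsum (f : ℝ × ℝ → ℝ≥0∞) :
    ∫⁻ z in openSquare, f z = ∑' b, ∫⁻ w in openSquare,
      ENNReal.ofReal (1 / branchDenom b w.1 ^ 3) * f (branch b w) := by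
  have hmeas (b : Digit) : MeasurableSet (branch b '' openSquare) :=
    measurableSet_openSquare.image_of_measurable_injOn (measurable_branch b) (injOn_branch b)
  have hdisj : Pairwise (Function.onFun Disjoint fun b => branch b '' openSquare) := by
    refine fun b b' hbb => disjoint_left.2 ?_
    rintro _ ⟨w, hw, rfl⟩ ⟨w', hw', h⟩
    exact hbb (eq_of_branch_eq hw' hw h).2.symm
  have hunion : (⋃ b, branch b '' openSquare) =ᵐ[volume] openSquare := by
    have hae := (ae_restrict_iff' measurableSet_openSquare).1 ae_mem_regularSet
    filter_upwards [hae] with z hz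
    refine propext ⟨fun h => ?_, fun h => ?_⟩
    · obtain ⟨b, w, hw, rfl⟩ := mem_iUnion.1 h
      exact branch_mem_openSquare b hw
    · obtain ⟨b, w, hw, hbw⟩ := exists_branch_eq (hz h)
      exact mem_iUnion.2 ⟨b, w, hw, hbw⟩
  rw [← setLIntegral_congr hunion, lintegral_iUnion hmeas hdisj]
  exact tsum_congr fun b => lintegral_image_branch b f

theorem measurePreserving_squareCoe :
    MeasurePreserving squareCoe volume (volume.restrict openSquare) := by
  have h := unitInterval.measurePreserving_coe.prod unitInterval.measurePreserving_coe
  rw [Measure.prod_restrict] at h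
  have hae : (openSquare : Set (ℝ × ℝ)) =ᵐ[volume] unitInterval ×ˢ unitInterval :=
    Measure.set_prod_ae_eq Ioo_ae_eq_Icc Ioo_ae_eq_Icc
  rw [Measure.restrict_congr_set hae]
  exact h

theorem ae_squareCoe_mem : ∀ᵐ q : unitInterval × unitInterval, squareCoe q ∈ openSquare :=
  measurePreserving_squareCoe.quasiMeasurePreserving.ae (ae_restrict_mem measurableSet_openSquare)

theorem measurable_squareProj : Measurable squareProj :=
  (continuous_projIcc.measurable.comp measurable_fst).prodMk
    (continuous_projIcc.measurable.comp measurable_snd)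

theorem measurable_branchJacobian (b : Digit) : Measurable (branchJacobian b) := by
  have hD : Measurable (branchDenom b) := by
    rcases b with ⟨n, a⟩ | ⟨n, a⟩ <;> unfold branchDenom <;> fun_prop
  unfold branchJacobian
  fun_prop

theorem measurable_squareBranch (b : Digit) : Measurable (squareBranch b) :=
  measurable_squareProj.comp ((measurable_branch b).comp measurableEmbedding_squareCoe.measurable)

theorem isFullBranched_fastMap :
    IsFullBranched fastMap volume squareBranch branchJacobian where
  measurable_map := measurable_fastMap
  measurable_branch := measurable_squareBranch
  measurable_jacobian := measurable_branchJacobian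
  lintegral_transfer f hf := by
    have h1 := measurePreserving_squareCoe.lintegral_comp (hf.comp measurable_squareProj)
    simp only [Function.comp, squareProj_squareCoe] at h1
    rw [h1, lintegral_openSquare_eq_tsum]
    simp only [transfer]
    refine (lintegral_tsum fun b => ((measurable_branchJacobian b).mul
      (hf.comp (measurable_squareBranch b))).aemeasurable).trans (tsum_congr fun b => ?_)
    exact measurePreserving_squareCoe.lintegral_comp_emb measurableEmbedding_squareCoe
      fun w => ENNReal.ofReal (1 / branchDenom b w.1 ^ 3) * f (squareProj (branch b w))
  map_branch := by
    filter_upwards [ae_squareCoe_mem] with q hq b using fastMap_squareBranch b hq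

end RotationRenormalization

theorem mainTheorem1 :
    ∃ μ : MeasureTheory.Measure (unitInterval × unitInterval),
      MeasureTheory.IsProbabilityMeasure μ ∧
      MeasureTheory.Measure.AbsolutelyContinuous μ MeasureTheory.volume ∧
      MeasureTheory.Measure.AbsolutelyContinuous MeasureTheory.volume μ ∧
      Ergodic RotationRenormalization.fastMap μ :=
  RotationRenormalization.isFullBranched_fastMap.exists_ergodic
    RotationRenormalization.hasBoundedDistortion_squareBranch zero_le_two
    RotationRenormalization.edist_le_projDist
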